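/- Fix an integer $d \ge 1$ and write $e(\theta) = e^{2\pi i\theta}$. For $\Gamma \subset \mathbb{Z}^d$ and $p>0$, say that $\Gamma$ has the strict majorant property on $L^p([0,1]^d)$ if $$\Big\| \sum_{n\in\Gamma} a_n e(n\cdot x) \Big\|_{L^p([0,1]^d)} \le \Big\| \sum_{n\in\Gamma} A_n e(n\cdot x) \Big\|_{L^p([0,1]^d)}$$ for all finitely supported families of real coefficients $(a_n)_{n\in\Gamma}$, $(A_n)_{n\in\Gamma}$ with $|a_n| \le A_n$ for every $n \in \Gamma$. Here $\|f\|_{L^p([0,1]^d)} = \big(\int_{[0,1]^d} |f(x)|^p\,dx\big)^{1/p}$. A set $\Gamma \subset \mathbb{Z}^d$ is affinely independent if for any $n_0 \in \Gamma$ the vectors $n - n_0$, $n \in \Gamma \setminus\{n_0\}$, are linearly independent over $\mathbb{Z}$. (1) A non-empty set $\Gamma \subset \mathbb{Z}^d$ has the strict majorant property on $L^p([0,1]^d)$ for every $p > 0$ if and only if $\Gamma$ is affinely independent. (2) If $\Gamma \subset \mathbb{Z}^d$ is not affinely independent, then there exist an integer $m \ge 0$ and finitely supported real coefficients $(a_n)_{n\in\Gamma}$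 such that for every $p \in (2m, 2m+2)$, $$\Big\| \sum_{n\in\Gamma} |a_n| e(n\cdot x) \Big\|_{L^p([0,1]^d)} < \Big\| \sum_{n\in\Gamma} a_n e(n\cdot x) \Big\|_{L^p([0,1]^d)}.$$ (3) In particular, the conclusion of (2) holds for every (finite or infinite) set $\Gamma \subset \mathbb{Z}^d$ of cardinality at least $d+2$. -/

import Mathlib

open MeasureTheory

noncomputable section

namespace StrictMajorant

/-- The additive character `e(θ) = exp(2πiθ)`. -/
def e (θ : ℝ) : ℂ := Complex.exp (2 * Real.pi * Complex.I * θ)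

/-- The pairing `n · x` of a frequency `n ∈ ℤ^d` with a point `x ∈ ℝ^d`. -/
def pairing {d : ℕ} (n : Fin d → ℤ) (x : Fin d → ℝ) : ℝ := ∑ i, (n i : ℝ) * x i

/-- The trigonometric polynomial `x ↦ ∑_{n ∈ Γ} a_n e(n · x)`. The coefficients are finitely
supported, so that the sum makes sense also for infinite `Γ`; for finite `Γ` this is no
restriction. -/
def trigPoly {d : ℕ} {Γ : Set (Fin d → ℤ)} (a : Γ →₀ ℝ) (x : Fin d → ℝ) : ℂ :=
  a.sum fun n c => (c : ℂ) * e (pairing (n : Fin d → ℤ) x)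

/-- The `L^p([0,1]^d)` norm (a quasi-norm for `p < 1`), `0 < p < ∞`, with respect to Lebesgue
measure. -/
def cubeNorm {d : ℕ} (p : ℝ) (f : (Fin d → ℝ) → ℂ) : ENNReal :=
  eLpNorm f (ENNReal.ofReal p) (volume.restrict (Set.Icc (0 : Fin d → ℝ) 1))

/-- The strict majorant property of `Γ ⊆ ℤ^d` on `L^p([0,1]^d)`. -/
def HasStrictMajorantProperty {d : ℕ} (Γ : Set (Fin d → ℤ)) (p : ℝ) : Prop :=
  ∀ a A : Γ →₀ ℝ, (∀ n, |a n| ≤ A n) → cubeNorm p (trigPoly a) ≤ cubeNorm p (trigPoly A)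

/-- The coefficients `(|a_n|)_{n ∈ Γ}`. -/
def absCoeff {d : ℕ} {Γ : Set (Fin d → ℤ)} (a : Γ →₀ ℝ) : Γ →₀ ℝ :=
  a.mapRange (fun t => |t|) abs_zero

/-- There are an integer `m ≥ 0` and real coefficients `a_n` such that, for every
`p ∈ (2m, 2m+2)`, replacing `a_n` by `|a_n|` strictly decreases the `L^p([0,1]^d)` norm. -/
def HasIntervalViolation {d : ℕ} (Γ : Set (Fin d → ℤ)) : Prop :=
  ∃ (m : ℕ) (a : Γ →₀ ℝ), ∀ p : ℝ, p ∈ Set.Ioo (2 * (m : ℝ)) (2 * (m : ℝ) + 2) →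
    cubeNorm p (trigPoly (absCoeff a)) < cubeNorm p (trigPoly a)

end StrictMajorant

end

/-!
Why the theorem is true.

*Independent frequencies.* If `Γ` is affinely independent, every `n₀ ∈ Γ` is separated from the
other frequencies by an affine function vanishing on them (`exists_pairing_eq`). Averaging over the
corresponding flow on the torus turns the phase of the coefficient at `n₀` into an independent
uniform phase `z`, with a common phase on all other terms (`integral_norm_sum_le`). So it suffices
that `A ↦ ∫ ‖w + A z‖ ^ p` is nondecreasing, for every `p > 0`
(`IsUniformPhase.integral_norm_add_mul_le`). For `‖w‖ > A` this follows from the identity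
`∫ ‖1 + u z‖ ^ (2 s) = ∑ₖ (s choose k) ^ 2 ‖u‖ ^ (2 k)`; for `‖w‖ < A` the point `w + A z` is
reflected to `A + conj w * z`, which has the same modulus; the case `‖w‖ = A` is a limit. The
coefficients are then enlarged one at a time.

*Dependent frequencies.* Otherwise there is a minimal affine relation `lam` in `Γ`, which generates
all relations on its support (`exists_circuit`). Single out `n₀` with `lam n₀ < 0`, let
`f = 1 + ε ∑ e((n - n₀) · x)` over the other points of the support, and let `g` arise from `f` by
flipping the sign of one coefficient with an odd exponent in the relation. Expanding
`‖1 + ε y‖ ^ (2 s)` in monomials `(s choose k) (s choose l) y ^ k * conj y ^ l` and integrating,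
the difference `∫ ‖f‖ ^ (2 s) - ∫ ‖g‖ ^ (2 s)` only involves pairs of monomials related by an odd
multiple of `lam`. If `K = m + 2` and `L < K` are the weights of the positive and negative parts
of `lam` away from `n₀`, the leading term is a positive multiple of
`(s choose K) (s choose L) ε ^ (K + L)`, and this is negative precisely because `m < s < m + 1`.
The ratios `(s choose (k + j)) / (s choose k)` are bounded uniformly in `s ∈ (m, m + 1)`
(`abs_choose_add_le`), so that a single small `ε` makes the leading term dominate for all
`p = 2 s ∈ (2 m, 2 m + 2)`, although it degenerates at the endpoints
(`exists_pos_forall_hasSum_neg`).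
-/

open MeasureTheory
open scoped ComplexConjugate

namespace StrictMajorant

/-! ### The binomial expansion of `‖1 + y‖ ^ (2 * s)` -/

theorem summable_choose_mul_pow (s : ℝ) {ρ : ℝ} (h0 : 0 ≤ ρ) (h1 : ρ < 1) :
    Summable fun k : ℕ => |Ring.choose s k| * ρ ^ k := by
  lift ρ to NNReal using h0
  have h := (binomialSeries ℝ s).summable_norm_mul_pow (r := ρ)
    (lt_of_lt_of_le (by exact_mod_cast h1) binomialSeries_radius_ge_one)
  simpa [binomialSeries] using h

theorem hasSum_one_add_cpow (s : ℝ) {y : ℂ} (hy : ‖y‖ < 1) :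
    HasSum (fun k : ℕ => ((Ring.choose s k : ℝ) : ℂ) * y ^ k) ((1 + y) ^ (s : ℂ)) := by
  have h := (Complex.one_add_cpow_hasFPowerSeriesOnBall_zero (a := (s : ℂ))).hasSum
    (y := y) (by simpa [enorm_eq_nnnorm, ← NNReal.coe_lt_coe] using hy)
  simpa [binomialSeries, Complex.ofReal_choose, mul_comm] using h

theorem hasSum_norm_sq_of_hasSum {c : ℕ → ℝ} {y w : ℂ}
    (h : HasSum (fun k : ℕ => (c k : ℂ) * y ^ k) w) (hn : Summable fun k => |c k| * ‖y‖ ^ k) :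
    HasSum (fun k : ℕ × ℕ => c k.1 * c k.2 * (y ^ k.1 * conj (y ^ k.2)).re) (‖w‖ ^ 2) := by
  have h' : HasSum (fun k : ℕ => conj ((c k : ℂ) * y ^ k)) (conj w) := by
    simpa using h.star
  have hs : Summable fun k : ℕ × ℕ => ((c k.1 : ℂ) * y ^ k.1) * conj ((c k.2 : ℂ) * y ^ k.2) :=
    summable_mul_of_summable_norm (f := fun k : ℕ => (c k : ℂ) * y ^ k)
      (g := fun k : ℕ => conj ((c k : ℂ) * y ^ k)) (by simpa using hn) (by simpa using hn)
  have hm := Complex.hasSum_re (h.mul h' hs)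
  rw [Complex.mul_conj, Complex.normSq_eq_norm_sq, Complex.ofReal_re] at hm
  convert hm using 2 with k
  rw [map_mul, Complex.conj_ofReal, mul_mul_mul_comm, ← Complex.ofReal_mul, Complex.re_ofReal_mul]

theorem hasSum_norm_one_add_rpow (s : ℝ) {y : ℂ} (hy : ‖y‖ < 1) :
    HasSum (fun k : ℕ × ℕ => Ring.choose s k.1 * Ring.choose s k.2 *
      (y ^ k.1 * conj (y ^ k.2)).re) (‖1 + y‖ ^ (2 * s)) := by
  have e : ‖1 + y‖ ^ (2 * s) = ‖(1 + y) ^ (s : ℂ)‖ ^ 2 := by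
    rw [Complex.norm_cpow_real, ← Real.rpow_natCast, ← Real.rpow_mul (norm_nonneg _), mul_comm]
    norm_num
  rw [e]
  exact hasSum_norm_sq_of_hasSum (c := fun k => Ring.choose s k) (hasSum_one_add_cpow s hy)
    (summable_choose_mul_pow s (norm_nonneg y) hy)

theorem hasSum_integral_norm_one_add_rpow {X : Type*} [MeasurableSpace X] (μ : Measure X)
    [IsProbabilityMeasure μ] (s : ℝ) {ρ : ℝ} (h1 : ρ < 1) {Y : X → ℂ}
    (hm : AEStronglyMeasurable Y μ) (hY : ∀ x, ‖Y x‖ ≤ ρ) :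
    HasSum (fun k : ℕ × ℕ => Ring.choose s k.1 * Ring.choose s k.2 *
      ∫ x, (Y x ^ k.1 * conj (Y x ^ k.2)).re ∂μ) (∫ x, ‖1 + Y x‖ ^ (2 * s) ∂μ) := by
  obtain ⟨x₀⟩ := μ.nonempty_of_neZero
  have h0 : 0 ≤ ρ := (norm_nonneg _).trans (hY x₀)
  have hb : ∀ (k : ℕ × ℕ) x, ‖Ring.choose s k.1 * Ring.choose s k.2 *
      (Y x ^ k.1 * conj (Y x ^ k.2)).re‖ ≤
      (|Ring.choose s k.1| * ρ ^ k.1) * (|Ring.choose s k.2| * ρ ^ k.2) := by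
    intro k x
    have : |(Y x ^ k.1 * conj (Y x ^ k.2)).re| ≤ ρ ^ k.1 * ρ ^ k.2 := by
      refine (Complex.abs_re_le_norm _).trans ?_
      rw [norm_mul, RCLike.norm_conj, norm_pow, norm_pow]
      gcongr <;> exact hY x
    rw [norm_mul, norm_mul, Real.norm_eq_abs, Real.norm_eq_abs, Real.norm_eq_abs]
    calc _ ≤ |Ring.choose s k.1| * |Ring.choose s k.2| * (ρ ^ k.1 * ρ ^ k.2) := by gcongr
      _ = _ := by ring
  have hms : ∀ k : ℕ × ℕ, AEStronglyMeasurable (fun x => Ring.choose s k.1 * Ring.choose s k.2 *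
      (Y x ^ k.1 * conj (Y x ^ k.2)).re) μ := fun k =>
    (Complex.continuous_re.comp_aestronglyMeasurable ((hm.pow _).mul
      (Complex.continuous_conj.comp_aestronglyMeasurable (hm.pow _)))).const_mul _
  have hsum := (summable_choose_mul_pow s h0 h1).mul_of_nonneg (summable_choose_mul_pow s h0 h1)
    (fun _ => by positivity) (fun _ => by positivity)
  have key := hasSum_integral_of_summable_integral_norm (μ := μ)
    (fun k => Integrable.of_bound (hms k) _ (Filter.Eventually.of_forall (hb k)))
    (hsum.of_nonneg_of_le (fun k => integral_nonneg fun x => norm_nonneg _) fun k => by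
      refine (integral_mono_of_nonneg (Filter.Eventually.of_forall fun x => norm_nonneg _)
        (integrable_const _) (Filter.Eventually.of_forall (hb k))).trans_eq ?_
      simp)
  simp_rw [integral_const_mul] at key
  rwa [integral_congr_ae (Filter.Eventually.of_forall fun x =>
    ((hasSum_norm_one_add_rpow s ((hY x).trans_lt h1)).tsum_eq))] at key

/-! ### Averages over a random phase -/

/-- `z` is a random variable of modulus one whose integer moments are those of the uniform
distribution on the unit circle. -/
structure IsUniformPhase {X : Type*} [MeasurableSpace X] (μ : Measure X) (z : X → ℂ) : Prop where
  aestronglyMeasurable : AEStronglyMeasurable z μ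
  norm_eq_one : ∀ x, ‖z x‖ = 1
  integral_eq : ∀ k l : ℕ, ∫ x, z x ^ k * conj (z x ^ l) ∂μ = if k = l then 1 else 0

namespace IsUniformPhase

variable {X : Type*} [MeasurableSpace X] {μ : Measure X} [IsProbabilityMeasure μ] {z : X → ℂ}

theorem integral_re_mul (hz : IsUniformPhase μ z) (u : ℂ) (k l : ℕ) :
    ∫ x, ((u * z x) ^ k * conj ((u * z x) ^ l)).re ∂μ = if k = l then ‖u‖ ^ (2 * k) else 0 := by
  have e : ∀ x, (u * z x) ^ k * conj ((u * z x) ^ l) =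
      (u ^ k * conj (u ^ l)) * (z x ^ k * conj (z x ^ l)) := by
    intro x; simp only [mul_pow, map_mul]; ring
  have hi : Integrable (fun x => (u * z x) ^ k * conj ((u * z x) ^ l)) μ := by
    have hm := hz.aestronglyMeasurable.const_mul u
    refine Integrable.of_bound ((hm.pow k).mul
      (Complex.continuous_conj.comp_aestronglyMeasurable (hm.pow l))) (‖u‖ ^ k * ‖u‖ ^ l)
      (Filter.Eventually.of_forall fun x => ?_)
    simp [hz.norm_eq_one]
  have h := integral_re (𝕜 := ℂ) hi
  simp only [RCLike.re_eq_complex_re] at h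
  rw [h]
  simp_rw [e]
  rw [integral_const_mul, hz.integral_eq]
  split_ifs with hkl
  · subst hkl
    rw [mul_one, Complex.mul_conj, Complex.normSq_eq_norm_sq, Complex.ofReal_re,
      norm_pow, ← pow_mul, mul_comm]
  · simp

theorem hasSum_integral (hz : IsUniformPhase μ z) (s : ℝ) {u : ℂ} (hu : ‖u‖ < 1) :
    HasSum (fun k : ℕ => Ring.choose s k ^ 2 * ‖u‖ ^ (2 * k))
      (∫ x, ‖1 + u * z x‖ ^ (2 * s) ∂μ) := by
  have h := hasSum_integral_norm_one_add_rpow μ s hu (Y := fun x => u * z x)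
    (hz.aestronglyMeasurable.const_mul u) (fun x => by simp [hz.norm_eq_one])
  simp_rw [hz.integral_re_mul] at h
  have hinj : Function.Injective fun k : ℕ => (k, k) := fun k l hkl => (Prod.ext_iff.1 hkl).1
  rw [← hinj.hasSum_iff] at h
  · simpa [Function.comp_def, sq] using h
  · rintro ⟨k, l⟩ hkl
    have : k ≠ l := by rintro rfl; exact hkl ⟨k, rfl⟩
    simp [this]

theorem integral_norm_one_add_mul_le (hz : IsUniformPhase μ z) (p : ℝ) {u v : ℂ}
    (huv : ‖u‖ ≤ ‖v‖) (hv : ‖v‖ < 1) :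
    ∫ x, ‖1 + u * z x‖ ^ p ∂μ ≤ ∫ x, ‖1 + v * z x‖ ^ p ∂μ := by
  have h1 := hz.hasSum_integral (p / 2) (huv.trans_lt hv)
  have h2 := hz.hasSum_integral (p / 2) hv
  rw [mul_div_cancel₀ p two_ne_zero] at h1 h2
  exact hasSum_le (fun k => by gcongr) h1 h2

theorem norm_add_mul_rpow_eq {w : ℂ} (hw : w ≠ 0) (a z : ℂ) (p : ℝ) :
    ‖w + a * z‖ ^ p = ‖w‖ ^ p * ‖1 + a / w * z‖ ^ p := by
  rw [← Real.mul_rpow (norm_nonneg _) (norm_nonneg _), ← norm_mul]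
  congr 2
  field_simp

/-- Reflection in the unit circle: for `‖z‖ = 1` the points `w + A z` and `A + conj w * z` have
the same modulus, and inside the circle the second one dominates. -/
theorem norm_add_mul_le_norm_add_conj_mul {w z : ℂ} (hz : ‖z‖ = 1) {A r : ℝ} (hw : ‖w‖ ≤ A)
    (hr : |r| ≤ 1) : ‖w + (A * r : ℝ) * z‖ ≤ ‖A + conj w * r * z‖ := by
  have hz' : z.re ^ 2 + z.im ^ 2 = 1 := by
    have := Complex.normSq_eq_norm_sq z
    rw [hz, Complex.normSq_apply] at this
    linarith
  have hw' : w.re ^ 2 + w.im ^ 2 ≤ A ^ 2 := by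
    have := Complex.normSq_eq_norm_sq w
    rw [Complex.normSq_apply] at this
    nlinarith [norm_nonneg w]
  refine le_of_sq_le_sq ?_ (norm_nonneg _)
  rw [← Complex.normSq_eq_norm_sq, ← Complex.normSq_eq_norm_sq, Complex.normSq_apply,
    Complex.normSq_apply]
  simp only [Complex.add_re, Complex.add_im, Complex.mul_re, Complex.mul_im, Complex.ofReal_re,
    Complex.ofReal_im, Complex.conj_re, Complex.conj_im]
  have hr' : r ^ 2 ≤ 1 := (sq_le_one_iff_abs_le_one r).2 hr
  have hp := mul_nonneg (sub_nonneg.2 hw') (sub_nonneg.2 hr')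
  have e : z.im ^ 2 = 1 - z.re ^ 2 := by linarith
  ring_nf at hp ⊢
  rw [e]
  nlinarith [hp]

theorem norm_add_mul_eq_norm_add_conj_mul {w z : ℂ} (hz : ‖z‖ = 1) (A : ℝ) :
    ‖w + A * z‖ = ‖A + conj w * z‖ := by
  have hz0 : conj z * z = 1 := by
    rw [mul_comm, Complex.mul_conj, Complex.normSq_eq_norm_sq, hz]; simp
  calc ‖w + A * z‖ = ‖conj (w + A * z)‖ := (RCLike.norm_conj _).symm
    _ = ‖conj (w + A * z) * z‖ := by rw [norm_mul, hz, mul_one]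
    _ = _ := by
      congr 1
      simp only [map_add, map_mul, Complex.conj_ofReal]
      linear_combination (A : ℂ) * hz0

theorem continuous_integral_norm_add_mul (hz : IsUniformPhase μ z) {p : ℝ} (hp : 0 < p) (w : ℂ) :
    Continuous fun A : ℝ => ∫ x, ‖w + A * z x‖ ^ p ∂μ := by
  rw [continuous_iff_continuousAt]
  intro A₀
  refine continuousAt_of_dominated (bound := fun _ => (‖w‖ + (|A₀| + 1)) ^ p)
    (Filter.Eventually.of_forall fun A => ?_) ?_ (integrable_const _)
    (Filter.Eventually.of_forall fun x => ?_)
  · exact (Real.continuous_rpow_const hp.le).comp_aestronglyMeasurable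
      ((hz.aestronglyMeasurable.const_mul _).const_add w).norm
  · filter_upwards [Metric.ball_mem_nhds A₀ one_pos] with A hA
    refine Filter.Eventually.of_forall fun x => ?_
    rw [Real.norm_of_nonneg (by positivity)]
    have h1 : |A| ≤ |A₀| + 1 := by
      have h2 : |A - A₀| < 1 := by simpa [Real.dist_eq] using hA
      have := abs_sub_abs_le_abs_sub A A₀
      linarith
    gcongr
    calc _ ≤ ‖w‖ + ‖(A : ℂ) * z x‖ := norm_add_le _ _
      _ ≤ _ := by simpa [hz.norm_eq_one] using h1
  · have : Continuous fun A : ℝ => ‖w + A * z x‖ ^ p :=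
      (Real.continuous_rpow_const hp.le).comp (by fun_prop)
    exact this.continuousAt

theorem integrable_norm_add_mul (hz : IsUniformPhase μ z) {p : ℝ} (hp : 0 < p) (w a : ℂ) :
    Integrable (fun x => ‖w + a * z x‖ ^ p) μ := by
  refine Integrable.of_bound ((Real.continuous_rpow_const hp.le).comp_aestronglyMeasurable
      ((hz.aestronglyMeasurable.const_mul _).const_add w).norm) ((‖w‖ + ‖a‖) ^ p)
      (Filter.Eventually.of_forall fun x => ?_)
  rw [Real.norm_of_nonneg (by positivity)]
  gcongr
  calc _ ≤ ‖w‖ + ‖a * z x‖ := norm_add_le _ _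
    _ ≤ _ := by simp [hz.norm_eq_one]

theorem integral_norm_add_mul_le_of_ne (hz : IsUniformPhase μ z) {p : ℝ} (hp : 0 < p) {w : ℂ}
    {a A : ℝ} (ha : |a| ≤ A) (hA : ‖w‖ ≠ A) :
    ∫ x, ‖w + a * z x‖ ^ p ∂μ ≤ ∫ x, ‖w + A * z x‖ ^ p ∂μ := by
  have hA0 : 0 ≤ A := (abs_nonneg a).trans ha
  rcases hA.lt_or_gt with hw | hw
  · have hA' : 0 < A := (norm_nonneg w).trans_lt hw
    have hAc : (A : ℂ) ≠ 0 := by exact_mod_cast hA'.ne'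
    have har : |a / A| ≤ 1 := by rwa [abs_div, abs_of_pos hA', div_le_one hA']
    have h1 : ∀ x, ‖w + a * z x‖ ^ p ≤ ‖(A : ℂ) + conj w * (a / A : ℝ) * z x‖ ^ p := by
      intro x
      have := norm_add_mul_le_norm_add_conj_mul (hz.norm_eq_one x) hw.le har
      rw [mul_div_cancel₀ _ hA'.ne'] at this
      gcongr
    have h2 : ∀ x, ‖w + A * z x‖ ^ p = ‖(A : ℂ) + conj w * z x‖ ^ p := fun x => by
      rw [norm_add_mul_eq_norm_add_conj_mul (hz.norm_eq_one x)]
    refine (integral_mono (hz.integrable_norm_add_mul hp _ _)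
      (hz.integrable_norm_add_mul hp _ _) h1).trans ?_
    simp_rw [h2, norm_add_mul_rpow_eq hAc]
    rw [integral_const_mul, integral_const_mul]
    refine mul_le_mul_of_nonneg_left (hz.integral_norm_one_add_mul_le p ?_ ?_) (by positivity)
    · rw [norm_div, norm_div, norm_mul, Complex.norm_real]
      gcongr
      exact mul_le_of_le_one_right (norm_nonneg _) har
    · rw [norm_div, RCLike.norm_conj, Complex.norm_real, Real.norm_of_nonneg hA0]
      exact (div_lt_one hA').2 hw
  · have hw0 : 0 < ‖w‖ := hA0.trans_lt hw
    simp_rw [norm_add_mul_rpow_eq (norm_pos_iff.1 hw0)]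
    rw [integral_const_mul, integral_const_mul]
    refine mul_le_mul_of_nonneg_left (hz.integral_norm_one_add_mul_le p ?_ ?_) (by positivity)
    · rw [norm_div, norm_div, Complex.norm_real, Complex.norm_real, Real.norm_of_nonneg hA0]
      gcongr
      exact ha
    · rw [norm_div, Complex.norm_real, Real.norm_of_nonneg hA0]
      exact (div_lt_one hw0).2 hw

/-- The `p`-th moment of `w + A z` is nondecreasing in the radius `A`, for every `p > 0`. -/
theorem integral_norm_add_mul_le (hz : IsUniformPhase μ z) {p : ℝ} (hp : 0 < p) (w : ℂ)
    {a A : ℝ} (ha : |a| ≤ A) :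
    ∫ x, ‖w + a * z x‖ ^ p ∂μ ≤ ∫ x, ‖w + A * z x‖ ^ p ∂μ := by
  by_cases hA : ‖w‖ = A
  · have ht : Filter.Tendsto (fun B : ℝ => ∫ x, ‖w + B * z x‖ ^ p ∂μ) (nhdsWithin A (Set.Ioi A))
        (nhds (∫ x, ‖w + A * z x‖ ^ p ∂μ)) :=
      ((hz.continuous_integral_norm_add_mul hp w).tendsto A).mono_left nhdsWithin_le_nhds
    refine ge_of_tendsto ht ?_
    filter_upwards [self_mem_nhdsWithin] with B hB
    exact hz.integral_norm_add_mul_le_of_ne hp (ha.trans (le_of_lt hB)) (hA.trans_ne (ne_of_lt hB))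
  · exact hz.integral_norm_add_mul_le_of_ne hp ha hA

end IsUniformPhase

/-! ### From the cube to the torus -/

/-- The covering map `ℝ^d → (ℝ/ℤ)^d`. -/
def torusMk {d : ℕ} (x : Fin d → ℝ) : UnitAddTorus (Fin d) := fun i => (x i : UnitAddCircle)

theorem measurePreserving_torusMk (d : ℕ) :
    MeasurePreserving (torusMk (d := d)) (volume.restrict (Set.Icc 0 1)) volume := by
  have h1 := measurePreserving_pi
    (fun _ : Fin d => (volume : Measure ℝ).restrict (Set.Ioc 0 (0 + 1)))
    (fun _ => (volume : Measure UnitAddCircle)) (fun _ => UnitAddCircle.measurePreserving_mk 0)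
  rw [← Measure.restrict_pi_pi, zero_add] at h1
  have h2 : (volume : Measure (Fin d → ℝ)).restrict (Set.Icc 0 1) =
      (Measure.pi fun _ => volume).restrict (Set.univ.pi fun _ => Set.Ioc (0 : ℝ) 1) :=
    (Measure.restrict_congr_set Measure.univ_pi_Ioc_ae_eq_Icc).symm
  rw [h2]
  exact h1

theorem fourier_coe_eq_e (n : ℤ) (x : ℝ) : fourier n (x : UnitAddCircle) = e (n * x) := by
  rw [fourier_coe_apply, e]
  push_cast
  congr 1
  ring

theorem e_add (x y : ℝ) : e (x + y) = e x * e y := by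
  simp only [e, ← Complex.exp_add]
  push_cast
  congr 1
  ring

theorem e_sum {ι : Type*} (s : Finset ι) (f : ι → ℝ) : e (∑ i ∈ s, f i) = ∏ i ∈ s, e (f i) := by
  simp only [e, ← Complex.exp_sum]
  push_cast
  rw [Finset.mul_sum]

theorem norm_e (x : ℝ) : ‖e x‖ = 1 := by
  have : (2 * Real.pi * Complex.I * x : ℂ) = (2 * Real.pi * x : ℝ) * Complex.I := by
    push_cast; ring
  rw [e, this, Complex.norm_exp_ofReal_mul_I]

theorem mFourier_torusMk {d : ℕ} (n : Fin d → ℤ) (x : Fin d → ℝ) :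
    UnitAddTorus.mFourier n (torusMk x) = e (pairing n x) := by
  rw [pairing, e_sum]
  change ∏ i, fourier (n i) (torusMk x i) = _
  exact Finset.prod_congr rfl fun i _ => fourier_coe_eq_e (n i) (x i)

theorem mFourier_apply_add {d : ℕ} (n : Fin d → ℤ) (s t : UnitAddTorus (Fin d)) :
    UnitAddTorus.mFourier n (s + t) = UnitAddTorus.mFourier n s * UnitAddTorus.mFourier n t := by
  simp only [UnitAddTorus.mFourier, ContinuousMap.coe_mk, ← Finset.prod_mul_distrib, Pi.add_apply]
  exact Finset.prod_congr rfl fun i _ => by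
    simp [fourier_apply, AddCircle.toCircle_add]

theorem norm_mFourier_apply {d : ℕ} (n : Fin d → ℤ) (t : UnitAddTorus (Fin d)) :
    ‖UnitAddTorus.mFourier n t‖ = 1 := by
  simp only [UnitAddTorus.mFourier, ContinuousMap.coe_mk, norm_prod, fourier_apply]
  exact Finset.prod_eq_one fun i _ => Circle.norm_coe _

theorem integral_fourier (n : ℤ) :
    ∫ t : UnitAddCircle, fourier n t = if n = 0 then 1 else 0 := by
  split_ifs with hn
  · simp [hn, Measure.real]
  · have h := integral_add_right_eq_self (μ := (volume : Measure UnitAddCircle))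
      (fun t => fourier n t) (((1 : ℝ) / 2 / n : ℝ) : UnitAddCircle)
    simp_rw [fourier_add_half_inv_index hn one_pos] at h
    rw [integral_neg] at h
    exact self_eq_neg.1 h.symm

theorem integral_mFourier {d : ℕ} (n : Fin d → ℤ) :
    ∫ t, UnitAddTorus.mFourier n t = if n = 0 then 1 else 0 := by
  have h : ∫ t, UnitAddTorus.mFourier n t = ∏ i, ∫ t : UnitAddCircle, fourier (n i) t :=
    integral_fintype_prod_volume_eq_prod (fun i t => fourier (n i) t)
  rw [h]
  simp_rw [integral_fourier]
  rw [Finset.prod_ite_zero]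
  simp [funext_iff]

theorem isUniformPhase_e :
    IsUniformPhase ((volume : Measure ℝ).restrict (Set.Ioc 0 1)) e where
  aestronglyMeasurable := by
    have : Continuous e := by unfold e; fun_prop
    exact this.aestronglyMeasurable
  norm_eq_one := norm_e
  integral_eq k l := by
    have h : ∀ x : ℝ, e x ^ k * conj (e x ^ l) = fourier ((k : ℤ) - l) (x : UnitAddCircle) := by
      intro x
      have h1 : e x = fourier 1 (x : UnitAddCircle) := by
        rw [fourier_coe_eq_e, Int.cast_one, one_mul]
      have h2 : ∀ m : ℕ, e x ^ m = fourier (m : ℤ) (x : UnitAddCircle) := by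
        intro m
        rw [h1]
        simp [fourier_apply, AddCircle.toCircle_nsmul]
      rw [h2, h2, ← fourier_neg, ← fourier_add, sub_eq_add_neg]
    simp_rw [h]
    have hm := UnitAddCircle.measurePreserving_mk 0
    rw [zero_add] at hm
    have h3 := integral_map (μ := (volume : Measure ℝ).restrict (Set.Ioc 0 1))
      hm.measurable.aemeasurable
      (f := fun t : UnitAddCircle => fourier ((k : ℤ) - l) t)
      (map_continuous _).aestronglyMeasurable
    rw [hm.map_eq, integral_fourier] at h3
    rw [← h3]
    simp [sub_eq_zero]

/-- The trigonometric polynomial `∑ a_n e(n · t)`, as a function on the torus. -/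
noncomputable def torusPoly {d : ℕ} {Γ : Set (Fin d → ℤ)} (a : Γ →₀ ℝ)
    (t : UnitAddTorus (Fin d)) : ℂ :=
  a.sum fun n c => (c : ℂ) * UnitAddTorus.mFourier (n : Fin d → ℤ) t

theorem continuous_torusPoly {d : ℕ} {Γ : Set (Fin d → ℤ)} (a : Γ →₀ ℝ) :
    Continuous (torusPoly a) := by
  unfold torusPoly Finsupp.sum
  fun_prop

theorem cubeNorm_trigPoly {d : ℕ} {Γ : Set (Fin d → ℤ)} (a : Γ →₀ ℝ) {p : ℝ} (hp : 0 < p) :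
    cubeNorm p (trigPoly a) = ENNReal.ofReal ((∫ t, ‖torusPoly a t‖ ^ p) ^ p⁻¹) := by
  have h : trigPoly a = torusPoly a ∘ torusMk := by
    ext x
    simp [trigPoly, torusPoly, mFourier_torusMk]
  have hc := continuous_torusPoly a
  rw [cubeNorm, h, eLpNorm_comp_measurePreserving hc.aestronglyMeasurable
    (measurePreserving_torusMk d)]
  have hm : MemLp (torusPoly a) (ENNReal.ofReal p) volume := by
    obtain ⟨C, hC⟩ := isCompact_univ.exists_bound_of_continuousOn hc.continuousOn
    exact MemLp.of_bound hc.aestronglyMeasurable C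
      (Filter.Eventually.of_forall fun t => hC t (Set.mem_univ t))
  rw [hm.eLpNorm_eq_integral_rpow_norm (by simpa using hp) ENNReal.ofReal_ne_top,
    ENNReal.toReal_ofReal hp.le]

theorem cubeNorm_trigPoly_le_iff {d : ℕ} {Γ : Set (Fin d → ℤ)} (a b : Γ →₀ ℝ) {p : ℝ}
    (hp : 0 < p) : cubeNorm p (trigPoly a) ≤ cubeNorm p (trigPoly b) ↔
      ∫ t, ‖torusPoly a t‖ ^ p ≤ ∫ t, ‖torusPoly b t‖ ^ p := by
  have h0 : ∀ c : Γ →₀ ℝ, 0 ≤ ∫ t, ‖torusPoly c t‖ ^ p := fun c =>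
    integral_nonneg fun t => by positivity
  rw [cubeNorm_trigPoly a hp, cubeNorm_trigPoly b hp, ENNReal.ofReal_le_ofReal_iff
    (Real.rpow_nonneg (h0 b) _), Real.rpow_le_rpow_iff (h0 a) (h0 b) (inv_pos.2 hp)]

theorem torusPoly_eq_sum {d : ℕ} {Γ : Set (Fin d → ℤ)} (a : Γ →₀ ℝ) {S : Finset Γ}
    (hS : a.support ⊆ S) (t : UnitAddTorus (Fin d)) :
    torusPoly a t = ∑ n ∈ S, (a n : ℂ) * UnitAddTorus.mFourier (n : Fin d → ℤ) t :=
  Finsupp.sum_of_support_subset _ hS _ (by simp)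

/-! ### Affinely independent frequencies -/

/-- Averaging a function on the torus over a one-parameter flow does not change its integral. -/
theorem integral_eq_integral_integral_flow {d : ℕ} {F : UnitAddTorus (Fin d) → ℝ}
    (hF : Continuous F) (y : Fin d → ℝ) :
    ∫ t, F t = ∫ t, ∫ s in Set.Ioc (0 : ℝ) 1, F (t + torusMk (s • y)) := by
  have hc : Continuous fun q : UnitAddTorus (Fin d) × ℝ => F (q.1 + torusMk (q.2 • y)) := by
    refine hF.comp (continuous_fst.add (continuous_pi fun i => ?_))
    exact (AddCircle.continuous_mk' 1).comp (by simp only [Pi.smul_apply]; fun_prop)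
  obtain ⟨C, hC⟩ := isCompact_univ.exists_bound_of_continuousOn hF.continuousOn
  rw [integral_integral_swap]
  · simp_rw [integral_add_right_eq_self F]
    simp
  · exact Integrable.of_bound hc.aestronglyMeasurable C
      (Filter.Eventually.of_forall fun t => hC _ (Set.mem_univ _))

/-- If some hyperplane contains every frequency except `n₀`, then the `p`-th moment is
nondecreasing in the modulus of the coefficient at `n₀`. -/
theorem integral_norm_sum_le {d : ℕ} {ι : Type*} [DecidableEq ι] (v : ι → Fin d → ℤ)
    (S : Finset ι) {n₀ : ι} (hn₀ : n₀ ∈ S) {y : Fin d → ℝ} {c : ℝ}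
    (hy₀ : pairing (v n₀) y = c + 1) (hy : ∀ n ∈ S, n ≠ n₀ → pairing (v n) y = c)
    {p : ℝ} (hp : 0 < p) {a A : ι → ℝ} (h₀ : |a n₀| ≤ A n₀) (h : ∀ n, n ≠ n₀ → a n = A n) :
    ∫ t, ‖∑ n ∈ S, (a n : ℂ) * UnitAddTorus.mFourier (v n) t‖ ^ p ≤
      ∫ t, ‖∑ n ∈ S, (A n : ℂ) * UnitAddTorus.mFourier (v n) t‖ ^ p := by
  have hcont : ∀ b : ι → ℝ, Continuous fun t : UnitAddTorus (Fin d) =>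
      ‖∑ n ∈ S, (b n : ℂ) * UnitAddTorus.mFourier (v n) t‖ ^ p := fun b =>
    (Real.continuous_rpow_const hp.le).comp (by fun_prop)
  -- The remaining frequencies contribute one common phase along the flow in direction `y`.
  have key : ∀ (b : ι → ℝ) (t : UnitAddTorus (Fin d)) (s : ℝ),
      ‖∑ n ∈ S, (b n : ℂ) * UnitAddTorus.mFourier (v n) (t + torusMk (s • y))‖ =
      ‖(∑ n ∈ S.erase n₀, (b n : ℂ) * UnitAddTorus.mFourier (v n) t) *
        conj (UnitAddTorus.mFourier (v n₀) t) + b n₀ * e s‖ := by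
    intro b t s
    have hpair : ∀ n, pairing (v n) (s • y) = s * pairing (v n) y := by
      intro n
      simp only [pairing, Pi.smul_apply, smul_eq_mul, Finset.mul_sum]
      exact Finset.sum_congr rfl fun i _ => by ring
    have hχ : UnitAddTorus.mFourier (v n₀) t * conj (UnitAddTorus.mFourier (v n₀) t) = 1 := by
      rw [Complex.mul_conj, Complex.normSq_eq_norm_sq, norm_mFourier_apply]; simp
    have e1 : ∑ n ∈ S, (b n : ℂ) * UnitAddTorus.mFourier (v n) (t + torusMk (s • y)) =
        e (s * c) * UnitAddTorus.mFourier (v n₀) t *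
        ((∑ n ∈ S.erase n₀, (b n : ℂ) * UnitAddTorus.mFourier (v n) t) *
        conj (UnitAddTorus.mFourier (v n₀) t) + b n₀ * e s) := by
      rw [← Finset.sum_erase_add _ _ hn₀]
      have e2 : ∀ n ∈ S.erase n₀,
          (b n : ℂ) * UnitAddTorus.mFourier (v n) (t + torusMk (s • y)) =
          (b n * UnitAddTorus.mFourier (v n) t) * e (s * c) := by
        intro n hn
        rw [mFourier_apply_add, mFourier_torusMk, hpair,
          hy n (Finset.mem_of_mem_erase hn) (Finset.ne_of_mem_erase hn)]
        ring
      rw [Finset.sum_congr rfl e2, ← Finset.sum_mul, mFourier_apply_add, mFourier_torusMk, hpair,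
        hy₀, mul_add, mul_one, e_add]
      linear_combination (-e (s * c) *
        (∑ n ∈ S.erase n₀, (b n : ℂ) * UnitAddTorus.mFourier (v n) t)) * hχ
    rw [e1, norm_mul, norm_mul, norm_e, norm_mFourier_apply, one_mul, one_mul]
  have hprob : IsProbabilityMeasure ((volume : Measure ℝ).restrict (Set.Ioc 0 1)) := ⟨by simp⟩
  rw [integral_eq_integral_integral_flow (hcont a) y,
    integral_eq_integral_integral_flow (hcont A) y]
  have hint : ∀ b : ι → ℝ, Integrable fun t : UnitAddTorus (Fin d) => ∫ s in Set.Ioc (0 : ℝ) 1,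
      ‖∑ n ∈ S, (b n : ℂ) * UnitAddTorus.mFourier (v n) (t + torusMk (s • y))‖ ^ p := by
    intro b
    have hc : Continuous fun q : UnitAddTorus (Fin d) × ℝ =>
        ‖∑ n ∈ S, (b n : ℂ) * UnitAddTorus.mFourier (v n) (q.1 + torusMk (q.2 • y))‖ ^ p := by
      refine (hcont b).comp (continuous_fst.add (continuous_pi fun i => ?_))
      exact (AddCircle.continuous_mk' 1).comp (by simp only [Pi.smul_apply]; fun_prop)
    obtain ⟨C, hC⟩ := isCompact_univ.exists_bound_of_continuousOn (hcont b).continuousOn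
    exact (Integrable.of_bound (μ := volume.prod (volume.restrict (Set.Ioc (0 : ℝ) 1)))
      hc.aestronglyMeasurable C
      (Filter.Eventually.of_forall fun t => hC _ (Set.mem_univ _))).integral_prod_left
  refine integral_mono (hint a) (hint A) fun t => ?_
  simp only [key]
  have e3 : ∑ n ∈ S.erase n₀, (a n : ℂ) * UnitAddTorus.mFourier (v n) t =
      ∑ n ∈ S.erase n₀, (A n : ℂ) * UnitAddTorus.mFourier (v n) t :=
    Finset.sum_congr rfl fun n hn => by rw [h n (Finset.ne_of_mem_erase hn)]
  rw [e3]
  exact isUniformPhase_e.integral_norm_add_mul_le hp _ h₀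

/-- The point `n ∈ ℤ^d` in homogeneous coordinates, as the rational vector `(n, 1)`. -/
def homCoord {d : ℕ} (n : Fin d → ℤ) : (Fin d → ℚ) × ℚ := (fun i => (n i : ℚ), 1)

theorem linearIndependent_homCoord {d : ℕ} {Γ : Set (Fin d → ℤ)}
    (h : AffineIndependent ℤ ((↑) : Γ → Fin d → ℤ)) :
    LinearIndependent ℚ fun n : Γ => homCoord (n : Fin d → ℤ) := by
  rw [← LinearIndependent.iff_fractionRing ℤ ℚ, linearIndependent_iff']
  intro S w hw
  rw [affineIndependent_iff] at h
  refine h S w ?_ ?_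
  · have := congrArg Prod.snd hw
    simp only [homCoord, Prod.snd_sum, Prod.smul_snd, Prod.snd_zero] at this
    simp only [zsmul_eq_mul, mul_one] at this
    exact_mod_cast this
  · ext i
    have := congrFun (congrArg Prod.fst hw) i
    simp only [homCoord, Prod.fst_sum, Prod.smul_fst, Prod.fst_zero, Finset.sum_apply,
      Pi.smul_apply, Pi.zero_apply] at this
    simp only [zsmul_eq_mul] at this
    simp only [Finset.sum_apply, Pi.smul_apply, smul_eq_mul, Pi.zero_apply]
    exact_mod_cast this

/-- Each vertex of an affinely independent set is separated from the others by an affine function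
that vanishes on all of them. -/
theorem exists_pairing_eq {d : ℕ} {Γ : Set (Fin d → ℤ)}
    (h : AffineIndependent ℤ ((↑) : Γ → Fin d → ℤ)) (n₀ : Γ) :
    ∃ (y : Fin d → ℝ) (c : ℝ), pairing (n₀ : Fin d → ℤ) y = c + 1 ∧
      ∀ n : Γ, n ≠ n₀ → pairing (n : Fin d → ℤ) y = c := by
  have hli := linearIndependent_homCoord h
  have hn : homCoord (n₀ : Fin d → ℤ) ∉ Submodule.span ℚ
      ((fun n : Γ => homCoord (n : Fin d → ℤ)) '' {n | n ≠ n₀}) :=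
    hli.notMem_span_image (by simp)
  obtain ⟨f, hf, hker⟩ := Submodule.exists_le_ker_of_notMem hn
  -- `f (n, 1) = ∑ i, n i * f (eᵢ, 0) + f (0, 1)`
  have hexp : ∀ n : Fin d → ℤ, (f (homCoord n) : ℝ) =
      pairing n (fun i => ((f (Pi.single i 1, 0) : ℚ) : ℝ)) + ((f (0, 1) : ℚ) : ℝ) := by
    intro n
    have e1 : homCoord n = (∑ i, (n i : ℚ) • ((Pi.single i 1, 0) : (Fin d → ℚ) × ℚ)) + (0, 1) := by
      ext i
      · simp [homCoord, Prod.fst_sum, Finset.sum_apply, Pi.single_apply]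
      · simp [homCoord, Prod.snd_sum]
    rw [e1, map_add, map_sum]
    simp only [map_smul, smul_eq_mul, pairing]
    push_cast
    rfl
  set q : ℝ := (f (homCoord (n₀ : Fin d → ℤ)) : ℝ) with hq
  have hq0 : q ≠ 0 := by rw [hq]; exact_mod_cast hf
  have hpair : ∀ n : Fin d → ℤ, pairing n (fun i => ((f (Pi.single i 1, 0) : ℚ) : ℝ) / q) =
      ((f (homCoord n) : ℝ) - ((f (0, 1) : ℚ) : ℝ)) / q := by
    intro n
    rw [hexp, add_sub_cancel_right]
    simp only [pairing, Finset.sum_div, mul_div_assoc]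
  refine ⟨fun i => ((f (Pi.single i 1, 0) : ℚ) : ℝ) / q, -((f (0, 1) : ℚ) : ℝ) / q, ?_, ?_⟩
  · rw [hpair, ← hq]
    field_simp
    ring
  · intro n hn
    have h0 : f (homCoord (n : Fin d → ℤ)) = 0 := hker (Submodule.subset_span ⟨n, hn, rfl⟩)
    rw [hpair, h0]
    simp

theorem hasStrictMajorantProperty_of_affineIndependent {d : ℕ} {Γ : Set (Fin d → ℤ)}
    (h : AffineIndependent ℤ ((↑) : Γ → Fin d → ℤ)) {p : ℝ} (hp : 0 < p) :
    HasStrictMajorantProperty Γ p := by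
  classical
  intro a A hA
  rw [cubeNorm_trigPoly_le_iff a A hp]
  set S := a.support ∪ A.support with hS
  simp_rw [torusPoly_eq_sum a (S := S) Finset.subset_union_left,
    torusPoly_eq_sum A (S := S) Finset.subset_union_right]
  -- Replace the coefficients of `a` by those of `A` one at a time.
  have key : ∀ U : Finset Γ, U ⊆ S →
      ∫ t, ‖∑ n ∈ S, (a n : ℂ) * UnitAddTorus.mFourier (n : Fin d → ℤ) t‖ ^ p ≤
      ∫ t, ‖∑ n ∈ S, (U.piecewise A a n : ℂ) * UnitAddTorus.mFourier (n : Fin d → ℤ) t‖ ^ p := by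
    intro U
    induction U using Finset.induction_on with
    | empty => intro _; simp
    | insert n₀ U hn₀ ih =>
      intro hU
      refine (ih ((Finset.subset_insert _ _).trans hU)).trans ?_
      obtain ⟨y, c, hy₀, hy⟩ := exists_pairing_eq h n₀
      refine integral_norm_sum_le (fun n : Γ => (n : Fin d → ℤ)) S
        (hU (Finset.mem_insert_self _ _)) hy₀ (fun n _ hn => hy n hn) hp ?_ ?_
      · simpa [hn₀] using hA n₀
      · intro n hn
        simp [Finset.piecewise, hn]
  have := key S le_rfl
  refine this.trans_eq (integral_congr_ae (Filter.Eventually.of_forall fun t => ?_))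
  dsimp only
  congr 2
  exact Finset.sum_congr rfl fun n hn => by simp [hn]

theorem not_affineIndependent_of_le_encard {d : ℕ} {Γ : Set (Fin d → ℤ)}
    (h : ((d + 2 : ℕ) : ℕ∞) ≤ Γ.encard) : ¬ AffineIndependent ℤ ((↑) : Γ → Fin d → ℤ) := by
  intro hai
  have hli := linearIndependent_homCoord hai
  have hfin : Finite Γ := hli.finite_of_isNoetherian
  have := Fintype.ofFinite Γ
  have hcard := hli.fintype_card_le_finrank
  rw [Set.encard_eq_coe_toFinset_card, Set.toFinset_card, Nat.cast_le] at h
  simp only [Module.finrank_prod, Module.finrank_fin_fun, Module.finrank_self] at hcard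
  omega

/-! ### Signs and sizes of binomial coefficients -/

theorem choose_succ_eq (s : ℝ) (k : ℕ) :
    Ring.choose s (k + 1) = Ring.choose s k * ((s - k) / (k + 1)) := by
  rw [Ring.choose_eq_smul, Ring.choose_eq_smul, descPochhammer_succ_right, Polynomial.smeval_mul,
    Polynomial.smeval_sub, Polynomial.smeval_X, Polynomial.smeval_natCast, Nat.factorial_succ]
  have : (k.factorial : ℝ) ≠ 0 := by positivity
  simp only [smul_eq_mul, pow_one, pow_zero, nsmul_eq_mul, mul_one]
  push_cast
  field_simp

theorem choose_pos_of_le {s : ℝ} {m : ℕ} (hs : (m : ℝ) < s) {k : ℕ} (hk : k ≤ m + 1) :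
    0 < Ring.choose s k := by
  induction k with
  | zero => simp
  | succ k ih =>
    have hk' : (k : ℝ) ≤ m := by exact_mod_cast Nat.le_of_succ_le_succ hk
    rw [choose_succ_eq]
    exact mul_pos (ih (by omega)) (div_pos (by linarith) (by positivity))

theorem choose_add_two_neg {s : ℝ} {m : ℕ} (hs : s ∈ Set.Ioo (m : ℝ) (m + 1)) :
    Ring.choose s (m + 2) < 0 := by
  rw [choose_succ_eq]
  refine mul_neg_of_pos_of_neg (choose_pos_of_le hs.1 le_rfl) (div_neg_of_neg_of_pos ?_ ?_)
  · push_cast; linarith [hs.2]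
  · positivity

/-- The ratios of binomial coefficients are bounded uniformly in `s ∈ (m, m + 1)`, also near the
endpoints, where the coefficients themselves tend to zero. -/
theorem abs_choose_add_le {s : ℝ} {m : ℕ} (hs : s ∈ Set.Ioo (m : ℝ) (m + 1)) (k j : ℕ) :
    |Ring.choose s (k + j)| ≤ (m + 1 : ℝ) ^ j * |Ring.choose s k| := by
  induction j with
  | zero => simp
  | succ j ih =>
    have hm : (0 : ℝ) ≤ m := by positivity
    have hr : |(s - (k + j : ℕ)) / ((k + j : ℕ) + 1)| ≤ m + 1 := by
      have h0 : (0 : ℝ) ≤ (k + j : ℕ) := by positivity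
      rw [abs_div, abs_of_pos (by positivity : (0 : ℝ) < (k + j : ℕ) + 1),
        div_le_iff₀ (by positivity), abs_le]
      constructor <;> nlinarith [hs.1, hs.2]
    rw [← add_assoc, choose_succ_eq, abs_mul, pow_succ]
    calc _ ≤ ((m + 1 : ℝ) ^ j * |Ring.choose s k|) * (m + 1) := by gcongr
      _ = _ := by ring

theorem abs_choose_le {s : ℝ} {m : ℕ} (hs : s ∈ Set.Ioo (m : ℝ) (m + 1)) {k n : ℕ} (h : k ≤ n) :
    |Ring.choose s n| ≤ (m + 1 : ℝ) ^ n * |Ring.choose s k| := by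
  obtain ⟨j, rfl⟩ := Nat.exists_eq_add_of_le h
  refine (abs_choose_add_le hs k j).trans ?_
  gcongr
  · linarith [(by positivity : (0 : ℝ) ≤ m)]
  · omega

/-- A double series supported on the two quadrants with corners `(m + 2, L)` and `(L, m + 2)`,
`L ≤ m + 1`, is dominated by its corner terms for small `ε`, uniformly in `s`. -/
theorem exists_pos_forall_hasSum_neg {m L : ℕ} (hL : L ≤ m + 1) {D : ℕ → ℕ → ℝ} {r : ℝ}
    (hr : 1 ≤ r) (hD : ∀ k l, |D k l| ≤ 2 * r ^ (k + l))
    (hsupp : ∀ k l, D k l ≠ 0 → (m + 2 ≤ k ∧ L ≤ l) ∨ (L ≤ k ∧ m + 2 ≤ l))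
    (hpos : 0 < D (m + 2) L) (hnonneg : 0 ≤ D L (m + 2)) :
    ∃ ε : ℝ, 0 < ε ∧ ε * r < 1 ∧ ∀ s ∈ Set.Ioo (m : ℝ) (m + 1), ∀ T : ℝ,
      HasSum (fun k : ℕ × ℕ => Ring.choose s k.1 * Ring.choose s k.2 *
        (ε ^ (k.1 + k.2) * D k.1 k.2)) T → T < 0 := by
  set C : ℝ := (m + 1) * r with hC
  have hm : (0 : ℝ) ≤ m := by positivity
  have hC1 : r ≤ C := by nlinarith
  have hC0 : 0 < C := by linarith
  set N := m + 2 + L with hN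
  set δ := D (m + 2) L with hδ
  set ε : ℝ := min (1 / (2 * C)) (δ / (16 * (2 * C) ^ (N + 1))) with hε
  have hε0 : 0 < ε := lt_min (by positivity) (by positivity)
  have hε1 : 2 * C * ε ≤ 1 := by
    have : ε ≤ 1 / (2 * C) := min_le_left _ _
    rwa [le_div_iff₀ (by positivity), mul_comm] at this
  have hε2 : 8 * (2 * C) ^ (N + 1) * ε < δ := by
    have : ε ≤ δ / (16 * (2 * C) ^ (N + 1)) := min_le_right _ _
    rw [le_div_iff₀ (by positivity)] at this
    have h1 : 0 < ε * (2 * C) ^ (N + 1) := by positivity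
    nlinarith
  refine ⟨ε, hε0, by nlinarith, fun s hs T hT => ?_⟩
  have hbK := choose_add_two_neg hs
  have hbL := choose_pos_of_le hs.1 hL
  set B := |Ring.choose s (m + 2)| * |Ring.choose s L| with hB
  have hBneg : Ring.choose s (m + 2) * Ring.choose s L = -B := by
    rw [hB, abs_of_neg hbK, abs_of_pos hbL]; ring
  have hB0 : 0 < B := mul_pos (abs_pos.2 hbK.ne) (abs_pos.2 hbL.ne')
  set E := 2 * B * (2 * C * ε) ^ (N + 1) with hE
  have hE0 : 0 ≤ E := by positivity
  -- every term other than the two corners is at most `E * 2⁻ᵏ * 2⁻ˡ`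
  have hterm : ∀ k l, (m + 2 ≤ k ∧ L ≤ l) ∨ (L ≤ k ∧ m + 2 ≤ l) → N + 1 ≤ k + l →
      |Ring.choose s k * Ring.choose s l * (ε ^ (k + l) * D k l)| ≤
        E * ((1 / 2) ^ k * (1 / 2) ^ l) := by
    intro k l hkl hN1
    have hb : |Ring.choose s k| * |Ring.choose s l| ≤ (m + 1 : ℝ) ^ (k + l) * B := by
      rcases hkl with ⟨h1, h2⟩ | ⟨h1, h2⟩
      · calc _ ≤ ((m + 1 : ℝ) ^ k * |Ring.choose s (m + 2)|) *
              ((m + 1 : ℝ) ^ l * |Ring.choose s L|) := by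
              gcongr
              exacts [abs_choose_le hs h1, abs_choose_le hs h2]
          _ = _ := by rw [hB, pow_add]; ring
      · calc _ ≤ ((m + 1 : ℝ) ^ k * |Ring.choose s L|) *
              ((m + 1 : ℝ) ^ l * |Ring.choose s (m + 2)|) := by
              gcongr
              exacts [abs_choose_le hs h1, abs_choose_le hs h2]
          _ = _ := by rw [hB, pow_add]; ring
    rw [abs_mul, abs_mul, abs_mul, abs_of_pos (pow_pos hε0 _)]
    calc _ ≤ ((m + 1 : ℝ) ^ (k + l) * B) * (ε ^ (k + l) * (2 * r ^ (k + l))) := by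
          gcongr; exact hD k l
      _ = 2 * B * (2 * C * ε) ^ (k + l) * ((1 / 2) ^ k * (1 / 2) ^ l) := by
          rw [hC, ← pow_add, mul_pow, mul_pow, mul_pow]
          have : (2 : ℝ) ^ (k + l) * (1 / 2) ^ (k + l) = 1 := by
            rw [← mul_pow]; norm_num
          linear_combination (-2 * B * (m + 1 : ℝ) ^ (k + l) * r ^ (k + l) * ε ^ (k + l)) * this
      _ ≤ _ := by
          exact mul_le_mul_of_nonneg_right (mul_le_mul_of_nonneg_left
            (pow_le_pow_of_le_one (by positivity) hε1 hN1) (by positivity)) (by positivity)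
  have hgeo : HasSum (fun k : ℕ × ℕ => ((1 : ℝ) / 2) ^ k.1 * (1 / 2) ^ k.2) (2 * 2) :=
    hasSum_geometric_two.mul hasSum_geometric_two
      (hasSum_geometric_two.summable.mul_of_nonneg hasSum_geometric_two.summable
        (fun _ => by positivity) (fun _ => by positivity))
  have hG := (hgeo.mul_left E).add (hasSum_ite_eq ((m + 2, L) : ℕ × ℕ) (-B * (ε ^ N * δ)))
  have hle := hasSum_le (fun k : ℕ × ℕ => ?_) hT hG
  · have h3 : E * (2 * 2) = B * ε ^ N * (8 * (2 * C) ^ (N + 1) * ε) := by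
      rw [hE, mul_pow, pow_succ ε]; ring
    rw [h3] at hle
    have h4 : 0 < B * ε ^ N := by positivity
    have h5 := mul_lt_mul_of_pos_left hε2 h4
    linarith
  · obtain ⟨k, l⟩ := k
    have hnn : 0 ≤ E * ((1 / 2 : ℝ) ^ k * (1 / 2) ^ l) := by positivity
    dsimp only
    by_cases h1 : (k, l) = (m + 2, L)
    · rw [if_pos h1]
      obtain ⟨rfl, rfl⟩ := Prod.mk.inj h1
      rw [hBneg]
      linarith
    rw [if_neg h1, add_zero]
    by_cases h2 : (k, l) = (L, m + 2)
    · obtain ⟨rfl, rfl⟩ := Prod.mk.inj h2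
      rw [mul_comm (Ring.choose s k), hBneg]
      have : 0 ≤ B * (ε ^ (k + (m + 2)) * D k (m + 2)) := by positivity
      linarith
    by_cases h3 : D k l = 0
    · rw [h3, mul_zero, mul_zero]; exact hnn
    · refine (le_abs_self _).trans (hterm k l (hsupp k l h3) ?_)
      have h4 : ¬ (k = m + 2 ∧ l = L) := fun h => h1 (by rw [h.1, h.2])
      have h5 : ¬ (k = L ∧ l = m + 2) := fun h => h2 (by rw [h.1, h.2])
      have := hsupp k l h3
      omega

/-! ### Moments of signed sums of characters -/

section Moments

variable {d : ℕ} {ι : Type*}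

instance isProbabilityMeasure_volume_torus :
    IsProbabilityMeasure (volume : Measure (UnitAddTorus (Fin d))) := by
  have : IsProbabilityMeasure (volume : Measure UnitAddCircle) := ⟨by simp⟩
  exact inferInstanceAs (IsProbabilityMeasure (Measure.pi fun _ => volume))

/-- The trigonometric polynomial `∑ i ∈ S, c i • e(v i · t)` on the torus. -/
noncomputable def charSum (v : ι → Fin d → ℤ) (S : Finset ι) (c : ι → ℝ)
    (t : UnitAddTorus (Fin d)) : ℂ :=
  ∑ i ∈ S, (c i : ℂ) * UnitAddTorus.mFourier (v i) t

theorem continuous_charSum (v : ι → Fin d → ℤ) (S : Finset ι) (c : ι → ℝ) :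
    Continuous (charSum v S c) := by
  unfold charSum
  fun_prop

theorem norm_charSum_le (v : ι → Fin d → ℤ) (S : Finset ι) {c : ι → ℝ} (hc : ∀ i, |c i| ≤ 1)
    (t : UnitAddTorus (Fin d)) : ‖charSum v S c t‖ ≤ S.card := by
  refine (norm_sum_le _ _).trans ?_
  rw [← nsmul_one, ← Finset.sum_const]
  exact Finset.sum_le_sum fun i _ => by simpa [norm_mFourier_apply] using hc i

theorem abs_integral_re_charSum_le (v : ι → Fin d → ℤ) (S : Finset ι) {c : ι → ℝ}
    (hc : ∀ i, |c i| ≤ 1) (k l : ℕ) :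
    |∫ t, (charSum v S c t ^ k * conj (charSum v S c t ^ l)).re| ≤ (S.card : ℝ) ^ (k + l) := by
  have h := norm_integral_le_of_norm_le_const (μ := (volume : Measure (UnitAddTorus (Fin d))))
    (f := fun t => (charSum v S c t ^ k * conj (charSum v S c t ^ l)).re)
    (C := (S.card : ℝ) ^ (k + l)) (Filter.Eventually.of_forall fun t => by
      refine (Complex.abs_re_le_norm _).trans ?_
      rw [norm_mul, RCLike.norm_conj, norm_pow, norm_pow, ← pow_add]
      have := norm_charSum_le v S hc t
      gcongr)
  simpa using h

theorem hasSum_integral_norm_one_add_charSum (v : ι → Fin d → ℤ) (S : Finset ι) {c : ι → ℝ}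
    (hc : ∀ i, |c i| ≤ 1) (s : ℝ) {ε : ℝ} (hε : 0 < ε) (h1 : ε * S.card < 1) :
    HasSum (fun k : ℕ × ℕ => Ring.choose s k.1 * Ring.choose s k.2 * (ε ^ (k.1 + k.2) *
      ∫ t, (charSum v S c t ^ k.1 * conj (charSum v S c t ^ k.2)).re))
      (∫ t, ‖1 + ε * charSum v S c t‖ ^ (2 * s)) := by
  have h := hasSum_integral_norm_one_add_rpow (volume : Measure (UnitAddTorus (Fin d))) s h1
    (Y := fun t => ε * charSum v S c t)
    ((continuous_charSum v S c).const_smul (ε : ℂ)).aestronglyMeasurable (fun t => by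
      rw [norm_mul, Complex.norm_real, Real.norm_of_nonneg hε.le]
      gcongr
      exact norm_charSum_le v S hc t)
  convert h using 2 with k
  rw [← integral_const_mul]
  congr 2
  ext t
  rw [← Complex.re_ofReal_mul]
  congr 1
  simp only [mul_pow, map_mul, map_pow, Complex.conj_ofReal, pow_add]
  push_cast
  ring

theorem mFourier_pow_apply (n : Fin d → ℤ) (k : ℕ) (t : UnitAddTorus (Fin d)) :
    UnitAddTorus.mFourier n t ^ k = UnitAddTorus.mFourier ((k : ℤ) • n) t := by
  induction k with
  | zero => simp [UnitAddTorus.mFourier_zero]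
  | succ k ih =>
    rw [pow_succ, ih, ← UnitAddTorus.mFourier_add]
    congr 2
    push_cast
    rw [add_smul, one_smul]

/-- The frequency of the monomial with exponents `α`. -/
def monomialFreq (v : ι → Fin d → ℤ) (S : Finset ι) (α : ι → ℕ) : Fin d → ℤ :=
  ∑ i ∈ S, (α i : ℤ) • v i

variable [DecidableEq ι]

theorem mFourier_sum_apply (S : Finset ι) (w : ι → Fin d → ℤ) (t : UnitAddTorus (Fin d)) :
    UnitAddTorus.mFourier (∑ i ∈ S, w i) t = ∏ i ∈ S, UnitAddTorus.mFourier (w i) t := by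
  induction S using Finset.induction_on with
  | empty => simp [UnitAddTorus.mFourier_zero]
  | insert i S hi ih => rw [Finset.sum_insert hi, Finset.prod_insert hi, ← ih,
      UnitAddTorus.mFourier_add]

theorem charSum_pow (v : ι → Fin d → ℤ) (S : Finset ι) (c : ι → ℝ) (k : ℕ)
    (t : UnitAddTorus (Fin d)) :
    charSum v S c t ^ k = ∑ α ∈ S.piAntidiag k,
      ((Nat.multinomial S α * ∏ i ∈ S, c i ^ α i : ℝ) : ℂ) *
        UnitAddTorus.mFourier (monomialFreq v S α) t := by
  rw [charSum, Finset.sum_pow_eq_sum_piAntidiag]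
  refine Finset.sum_congr rfl fun α _ => ?_
  rw [monomialFreq, mFourier_sum_apply]
  simp_rw [mul_pow, Finset.prod_mul_distrib, mFourier_pow_apply]
  push_cast
  ring

/-- Orthogonality: a mixed moment of a sum of characters counts pairs of monomials with the same
frequency, weighted by their coefficients. -/
theorem integral_re_charSum_pow_mul (v : ι → Fin d → ℤ) (S : Finset ι) (c : ι → ℝ) (k l : ℕ) :
    ∫ t, (charSum v S c t ^ k * conj (charSum v S c t ^ l)).re =
      ∑ α ∈ S.piAntidiag k, ∑ β ∈ S.piAntidiag l,
        if monomialFreq v S α = monomialFreq v S β then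
          (Nat.multinomial S α * Nat.multinomial S β : ℝ) * ∏ i ∈ S, c i ^ (α i + β i)
        else 0 := by
  have h1 : ∀ t : UnitAddTorus (Fin d), charSum v S c t ^ k * conj (charSum v S c t ^ l) =
      ∑ α ∈ S.piAntidiag k, ∑ β ∈ S.piAntidiag l,
        ((Nat.multinomial S α * Nat.multinomial S β * ∏ i ∈ S, c i ^ (α i + β i) : ℝ) : ℂ) *
        UnitAddTorus.mFourier (monomialFreq v S α - monomialFreq v S β) t := by
    intro t
    rw [charSum_pow, charSum_pow, map_sum, Finset.sum_mul_sum]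
    refine Finset.sum_congr rfl fun α _ => Finset.sum_congr rfl fun β _ => ?_
    rw [map_mul, Complex.conj_ofReal, sub_eq_add_neg, UnitAddTorus.mFourier_add,
      UnitAddTorus.mFourier_neg]
    simp_rw [pow_add, Finset.prod_mul_distrib]
    push_cast
    ring
  have hint : ∀ (w : ℂ) (n : Fin d → ℤ), Integrable fun t : UnitAddTorus (Fin d) =>
      w * UnitAddTorus.mFourier n t := fun w n =>
    Integrable.of_bound (by fun_prop) ‖w‖
      (Filter.Eventually.of_forall fun t => by simp [norm_mFourier_apply])
  have h2 := integral_re (𝕜 := ℂ) (μ := (volume : Measure (UnitAddTorus (Fin d))))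
    (f := fun t => charSum v S c t ^ k * conj (charSum v S c t ^ l)) (by
      simp_rw [h1]
      exact integrable_finsetSum _ fun α _ => integrable_finsetSum _ fun β _ => hint _ _)
  simp only [RCLike.re_eq_complex_re] at h2
  rw [h2]
  simp_rw [h1]
  rw [integral_finsetSum _ fun α _ => integrable_finsetSum _ fun β _ => hint _ _, Complex.re_sum]
  refine Finset.sum_congr rfl fun α _ => ?_
  rw [integral_finsetSum _ fun β _ => hint _ _, Complex.re_sum]
  refine Finset.sum_congr rfl fun β _ => ?_
  rw [integral_const_mul, integral_mFourier, Complex.re_ofReal_mul]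
  simp only [sub_eq_zero]
  split_ifs <;> simp

/-- The coefficients `1`, except for `-1` at the single index `j`. -/
def flipSign (j : ι) (i : ι) : ℝ := if i = j then -1 else 1

theorem prod_flipSign_pow {S : Finset ι} {j : ι} (hj : j ∈ S) (α : ι → ℕ) :
    ∏ i ∈ S, flipSign j i ^ α i = (-1) ^ α j := by
  rw [Finset.prod_eq_single j]
  · simp [flipSign]
  · intro i _ hi
    simp [flipSign, hi]
  · exact fun h => absurd hj h

/-- How much the mixed moment of order `(k, l)` drops when the sign at `j` is flipped. -/
noncomputable def momentDrop (v : ι → Fin d → ℤ) (S : Finset ι) (j : ι) (k l : ℕ) : ℝ :=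
  (∫ t, (charSum v S 1 t ^ k * conj (charSum v S 1 t ^ l)).re) -
    ∫ t, (charSum v S (flipSign j) t ^ k * conj (charSum v S (flipSign j) t ^ l)).re

theorem momentDrop_eq_sum (v : ι → Fin d → ℤ) {S : Finset ι} {j : ι} (hj : j ∈ S) (k l : ℕ) :
    momentDrop v S j k l = ∑ α ∈ S.piAntidiag k, ∑ β ∈ S.piAntidiag l,
      if monomialFreq v S α = monomialFreq v S β then
        (Nat.multinomial S α * Nat.multinomial S β : ℝ) * (1 - (-1) ^ (α j + β j)) else 0 := by
  rw [momentDrop, integral_re_charSum_pow_mul, integral_re_charSum_pow_mul,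
    ← Finset.sum_sub_distrib]
  refine Finset.sum_congr rfl fun α _ => ?_
  rw [← Finset.sum_sub_distrib]
  refine Finset.sum_congr rfl fun β _ => ?_
  rw [prod_flipSign_pow hj fun i => α i + β i]
  split_ifs <;> simp [mul_sub]

theorem one_sub_neg_one_pow_nonneg (n : ℕ) : (0 : ℝ) ≤ 1 - (-1) ^ n := by
  rcases neg_one_pow_eq_or ℝ n with h | h <;> rw [h] <;> norm_num

theorem momentDrop_nonneg (v : ι → Fin d → ℤ) {S : Finset ι} {j : ι} (hj : j ∈ S) (k l : ℕ) :
    0 ≤ momentDrop v S j k l := by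
  rw [momentDrop_eq_sum v hj]
  refine Finset.sum_nonneg fun α _ => Finset.sum_nonneg fun β _ => ?_
  split_ifs
  · exact mul_nonneg (by positivity) (one_sub_neg_one_pow_nonneg _)
  · exact le_rfl

theorem momentDrop_pos (v : ι → Fin d → ℤ) {S : Finset ι} {j : ι} (hj : j ∈ S) {k l : ℕ}
    {α β : ι → ℕ} (hα : α ∈ S.piAntidiag k) (hβ : β ∈ S.piAntidiag l)
    (hf : monomialFreq v S α = monomialFreq v S β) (hodd : Odd (α j + β j)) :
    0 < momentDrop v S j k l := by
  have h0 : ∀ α β : ι → ℕ, 0 ≤ if monomialFreq v S α = monomialFreq v S β then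
        (Nat.multinomial S α * Nat.multinomial S β : ℝ) * (1 - (-1) ^ (α j + β j)) else 0 := by
    intro α β
    split_ifs
    · exact mul_nonneg (by positivity) (one_sub_neg_one_pow_nonneg _)
    · exact le_rfl
  rw [momentDrop_eq_sum v hj]
  refine Finset.sum_pos' (fun α _ => Finset.sum_nonneg fun β _ => h0 α β) ⟨α, hα, ?_⟩
  refine Finset.sum_pos' (fun β _ => h0 α β) ⟨β, hβ, ?_⟩
  rw [if_pos hf, hodd.neg_one_pow]
  have h1 : 0 < Nat.multinomial S α := Nat.multinomial_pos _ _
  have h2 : 0 < Nat.multinomial S β := Nat.multinomial_pos _ _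
  positivity

theorem exists_of_momentDrop_ne_zero (v : ι → Fin d → ℤ) {S : Finset ι} {j : ι} (hj : j ∈ S)
    {k l : ℕ} (h : momentDrop v S j k l ≠ 0) :
    ∃ α ∈ S.piAntidiag k, ∃ β ∈ S.piAntidiag l,
      monomialFreq v S α = monomialFreq v S β ∧ Odd (α j + β j) := by
  rw [momentDrop_eq_sum v hj] at h
  obtain ⟨α, hα, h⟩ := Finset.exists_ne_zero_of_sum_ne_zero h
  obtain ⟨β, hβ, h⟩ := Finset.exists_ne_zero_of_sum_ne_zero h
  refine ⟨α, hα, β, hβ, ?_⟩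
  split_ifs at h with hf
  · refine ⟨hf, ?_⟩
    by_contra hev
    rw [Nat.not_odd_iff_even] at hev
    simp [hev.neg_one_pow] at h
  · exact absurd rfl h

theorem abs_flipSign (j i : ι) : |flipSign j i| = 1 := by
  unfold flipSign
  split_ifs <;> simp

theorem abs_momentDrop_le (v : ι → Fin d → ℤ) (S : Finset ι) (j : ι) (k l : ℕ) :
    |momentDrop v S j k l| ≤ 2 * (S.card : ℝ) ^ (k + l) := by
  rw [two_mul]
  exact (abs_sub _ _).trans (add_le_add (abs_integral_re_charSum_le v S (by simp) k l)
    (abs_integral_re_charSum_le v S (fun i => (abs_flipSign j i).le) k l))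

/-- Let `lam` generate the integral relations between the vectors `v i`, with positive part of
weight `m + 2` and negative part of smaller weight. Flipping the sign of one coefficient with an
odd exponent in this relation increases the `p`-th moment of `1 + ε ∑ e(v i · t)`, for one small
`ε` and all `p` strictly between `2 m` and `2 m + 2`. -/
theorem exists_forall_integral_lt (v : ι → Fin d → ℤ) {S : Finset ι} {j : ι} (hj : j ∈ S)
    {lam : ι → ℤ} (hlam : ∑ i ∈ S, lam i • v i = 0)
    (hgen : ∀ μ : ι → ℤ, ∑ i ∈ S, μ i • v i = 0 → ∃ q : ℤ, ∀ i ∈ S, μ i = q * lam i)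
    (hodd : Odd (lam j)) {m L : ℕ} (hK : ∑ i ∈ S, (lam i).toNat = m + 2)
    (hL : ∑ i ∈ S, (-lam i).toNat = L) (hLm : L ≤ m + 1) :
    ∃ ε : ℝ, 0 < ε ∧ ∀ p ∈ Set.Ioo (2 * (m : ℝ)) (2 * m + 2),
      ∫ t, ‖1 + ε * charSum v S 1 t‖ ^ p < ∫ t, ‖1 + ε * charSum v S (flipSign j) t‖ ^ p := by
  have hcard : (1 : ℝ) ≤ S.card := by exact_mod_cast Finset.card_pos.2 ⟨j, hj⟩
  -- the positive and negative parts of `lam`, as exponents of monomials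
  have hpos : 0 < momentDrop v S j (m + 2) L := by
    refine momentDrop_pos v hj (α := fun i => if i ∈ S then (lam i).toNat else 0)
      (β := fun i => if i ∈ S then (-lam i).toNat else 0) ?_ ?_ ?_ ?_
    · rw [Finset.mem_piAntidiag]
      exact ⟨by rw [← hK]; exact Finset.sum_congr rfl fun i hi => if_pos hi,
        fun i hi => by_contra fun h => hi (if_neg h)⟩
    · rw [Finset.mem_piAntidiag]
      exact ⟨by rw [← hL]; exact Finset.sum_congr rfl fun i hi => if_pos hi,
        fun i hi => by_contra fun h => hi (if_neg h)⟩
    · rw [← sub_eq_zero, monomialFreq, monomialFreq, ← Finset.sum_sub_distrib, ← hlam]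
      refine Finset.sum_congr rfl fun i hi => ?_
      rw [if_pos hi, if_pos hi, ← sub_smul]
      congr 1
      omega
    · simp only [if_pos hj]
      rcases hodd with ⟨a, ha⟩
      rw [Nat.odd_iff]
      omega
  have hsupp : ∀ k l, momentDrop v S j k l ≠ 0 →
      (m + 2 ≤ k ∧ L ≤ l) ∨ (L ≤ k ∧ m + 2 ≤ l) := by
    intro k l hkl
    obtain ⟨α, hα, β, hβ, hf, ho⟩ := exists_of_momentDrop_ne_zero v hj hkl
    rw [Finset.mem_piAntidiag] at hα hβ
    obtain ⟨q, hq⟩ := hgen (fun i => (α i : ℤ) - β i) (by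
      simp_rw [sub_smul]
      rw [Finset.sum_sub_distrib, sub_eq_zero]
      exact hf)
    have hq0 : q ≠ 0 := by
      rintro rfl
      have := hq j hj
      rw [Nat.odd_iff] at ho
      omega
    rw [← hα.1, ← hβ.1, ← hK, ← hL]
    rcases lt_or_gt_of_ne hq0 with hneg | hpos
    · right
      constructor
      all_goals
        refine Finset.sum_le_sum fun i hi => ?_
        have := hq i hi
        zify
        rw [Int.toNat_eq_max, max_le_iff]
        constructor
        · nlinarith [this]
        · positivity
    · left
      constructor
      all_goals
        refine Finset.sum_le_sum fun i hi => ?_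
        have := hq i hi
        zify
        rw [Int.toNat_eq_max, max_le_iff]
        constructor
        · nlinarith [this]
        · positivity
  obtain ⟨ε, hε0, hε1, hε⟩ := exists_pos_forall_hasSum_neg hLm hcard
    (fun k l => abs_momentDrop_le v S j k l) hsupp hpos (momentDrop_nonneg v hj _ _)
  refine ⟨ε, hε0, fun p hp => ?_⟩
  have h1 := hasSum_integral_norm_one_add_charSum v S (c := 1) (by simp) (p / 2) hε0 hε1
  have h2 := hasSum_integral_norm_one_add_charSum v S (c := flipSign j)
    (fun i => (abs_flipSign j i).le) (p / 2) hε0 hε1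
  have h3 := h1.sub h2
  simp only [← mul_sub] at h3
  have h4 := hε (p / 2) ⟨by linarith [hp.1], by linarith [hp.2]⟩ _ h3
  rw [mul_div_cancel₀ p two_ne_zero] at h4
  exact sub_neg.1 h4

end Moments

/-! ### Minimal relations -/

/-- If a linear map from a free abelian group to a torsion-free group is not injective, then its
kernel has a nonzero element that generates all elements of the kernel supported in its support.
Such an element has an odd coordinate, as otherwise its half would be a relation as well. -/
theorem exists_generating_relation {ι V : Type*} [AddCommGroup V] [IsAddTorsionFree V]
    (φ : (ι →₀ ℤ) →ₗ[ℤ] V) (hφ : ∃ w, w ≠ 0 ∧ φ w = 0) :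
    ∃ lam : ι →₀ ℤ, lam ≠ 0 ∧ φ lam = 0 ∧
      (∀ μ : ι →₀ ℤ, μ.support ⊆ lam.support → φ μ = 0 → ∃ q : ℤ, μ = q • lam) ∧
      ∃ j, Odd (lam j) := by
  classical
  -- first minimize the size of the support, then one fixed coordinate
  obtain ⟨w, ⟨hw0, hw⟩, hwmin⟩ := exists_minimalFor_of_wellFoundedLT
    (fun w : ι →₀ ℤ => w ≠ 0 ∧ φ w = 0) (fun w => w.support.card) hφ
  obtain ⟨i₀, hi₀⟩ := Finsupp.support_nonempty_iff.2 hw0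
  have hzero : ∀ ν : ι →₀ ℤ, ν.support ⊆ w.support → φ ν = 0 → ν i₀ = 0 → ν = 0 := by
    intro ν hsub hν hν0
    by_contra hne
    have hlt : ν.support.card < w.support.card :=
      Finset.card_lt_card ⟨hsub, fun h => by simpa [hν0] using h hi₀⟩
    exact absurd (hwmin ⟨hne, hν⟩ hlt.le) hlt.not_ge
  obtain ⟨lam, ⟨hl0, hl, hlsub⟩, hlmin⟩ := exists_minimalFor_of_wellFoundedLT
    (fun μ : ι →₀ ℤ => μ ≠ 0 ∧ φ μ = 0 ∧ μ.support ⊆ w.support) (fun μ => (μ i₀).natAbs)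
    ⟨w, hw0, hw, le_rfl⟩
  have hli : lam i₀ ≠ 0 := fun h => hl0 (hzero lam hlsub hl h)
  have hgen : ∀ μ : ι →₀ ℤ, μ.support ⊆ lam.support → φ μ = 0 → ∃ q : ℤ, μ = q • lam := by
    intro μ hsub hμ
    refine ⟨μ i₀ / lam i₀, ?_⟩
    by_contra hne
    have hν0 : μ - (μ i₀ / lam i₀) • lam ≠ 0 := sub_ne_zero.2 hne
    have hν : φ (μ - (μ i₀ / lam i₀) • lam) = 0 := by rw [map_sub, map_smul, hμ, hl]; simp
    have hνsub : (μ - (μ i₀ / lam i₀) • lam).support ⊆ w.support :=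
      Finsupp.support_sub.trans (Finset.union_subset (hsub.trans hlsub)
        (Finsupp.support_smul.trans hlsub))
    have hval : (μ - (μ i₀ / lam i₀) • lam) i₀ = μ i₀ % lam i₀ := by
      rw [Finsupp.sub_apply, Finsupp.smul_apply, smul_eq_mul, Int.emod_def, mul_comm]
    have hlt : ((μ - (μ i₀ / lam i₀) • lam) i₀).natAbs < (lam i₀).natAbs := by
      rw [hval]
      have h1 := Int.emod_nonneg (μ i₀) hli
      have h2 := Int.emod_lt_abs (μ i₀) hli
      rw [Int.abs_eq_natAbs] at h2
      omega
    exact absurd (hlmin ⟨hν0, hν, hνsub⟩ hlt.le) hlt.not_ge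
  refine ⟨lam, hl0, hl, hgen, ?_⟩
  by_contra hev
  push Not at hev
  have hhalf : ∀ i, 2 * (lam i / 2) = lam i := fun i =>
    Int.two_mul_ediv_two_of_even (Int.not_odd_iff_even.1 (hev i))
  set μ : ι →₀ ℤ := lam.mapRange (fun x => x / 2) (by simp) with hμdef
  have hμ2 : (2 : ℕ) • μ = lam := by
    ext i
    simp [hμdef, hhalf]
  have hμ : φ μ = 0 := by
    have : (2 : ℕ) • φ μ = 0 := by rw [← map_nsmul, hμ2, hl]
    exact (nsmul_eq_zero_iff_right two_ne_zero).1 this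
  obtain ⟨q, hq⟩ := hgen μ Finsupp.support_mapRange hμ
  have h1 : lam i₀ / 2 = q * lam i₀ := by
    have := DFunLike.congr_fun hq i₀
    simpa [hμdef] using this
  have h2 : lam i₀ * (2 * q - 1) = 0 := by linear_combination hhalf i₀ - 2 * h1
  rcases mul_eq_zero.1 h2 with h | h
  · exact hli h
  · omega

theorem sum_toNat_sub_sum_toNat_neg {ι : Type*} (S : Finset ι) (lam : ι → ℤ) :
    ((∑ i ∈ S, (lam i).toNat : ℕ) : ℤ) - (∑ i ∈ S, (-lam i).toNat : ℕ) = ∑ i ∈ S, lam i := by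
  push_cast
  rw [← Finset.sum_sub_distrib]
  exact Finset.sum_congr rfl fun i _ => by omega

/-- A set that is not affinely independent contains a point `n₀` and finitely many points whose
differences with `n₀` satisfy the hypotheses of `exists_forall_integral_lt`. -/
theorem exists_circuit {d : ℕ} {Γ : Set (Fin d → ℤ)}
    (h : ¬ AffineIndependent ℤ ((↑) : Γ → Fin d → ℤ)) :
    ∃ (n₀ : Γ) (S : Finset Γ) (lam : Γ → ℤ) (j : Γ) (m L : ℕ), n₀ ∉ S ∧ j ∈ S ∧
      ∑ i ∈ S, lam i • ((i : Fin d → ℤ) - n₀) = 0 ∧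
      (∀ μ : Γ → ℤ, ∑ i ∈ S, μ i • ((i : Fin d → ℤ) - n₀) = 0 →
        ∃ q : ℤ, ∀ i ∈ S, μ i = q * lam i) ∧
      Odd (lam j) ∧ ∑ i ∈ S, (lam i).toNat = m + 2 ∧ ∑ i ∈ S, (-lam i).toNat = L ∧
      L ≤ m + 1 := by
  classical
  set φ : (Γ →₀ ℤ) →ₗ[ℤ] ((Fin d → ℤ) × ℤ) :=
    Finsupp.linearCombination ℤ fun n : Γ => ((n : Fin d → ℤ), (1 : ℤ)) with hφdef
  -- membership in the kernel of `φ`, for a family supported in `T`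
  have hφ : ∀ (w : Γ →₀ ℤ) (T : Finset Γ), w.support ⊆ T →
      (φ w = 0 ↔ ∑ i ∈ T, w i • (i : Fin d → ℤ) = 0 ∧ ∑ i ∈ T, w i = 0) := by
    intro w T hT
    rw [hφdef, Finsupp.linearCombination_apply, Finsupp.sum_of_support_subset _ hT _ (by simp),
      Prod.ext_iff]
    simp [Prod.fst_sum, Prod.snd_sum]
  have hex : ∃ w, w ≠ 0 ∧ φ w = 0 := by
    rw [affineIndependent_iff] at h
    push Not at h
    obtain ⟨T, w, hw1, hw2, i, hi, hwi⟩ := h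
    have hval : ∀ k ∈ T, (Finsupp.indicator T fun k _ => w k) k = w k := fun k hk =>
      Finsupp.indicator_of_mem hk _
    refine ⟨Finsupp.indicator T fun k _ => w k, fun h0 => hwi ?_,
      (hφ _ T (Finsupp.support_indicator_subset _ _)).2 ⟨?_, ?_⟩⟩
    · rw [← hval i hi, h0]; rfl
    · rw [← hw2]; exact Finset.sum_congr rfl fun k hk => by rw [hval k hk]
    · rw [← hw1]; exact Finset.sum_congr rfl fun k hk => hval k hk
  obtain ⟨lam, hl0, hl, hgen, j, hj⟩ := exists_generating_relation φ hex
  obtain ⟨hl1, hl2⟩ := (hφ lam lam.support le_rfl).1 hl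
  have hneg : ∃ n₀ ∈ lam.support, lam n₀ < 0 := by
    by_contra hnn
    push Not at hnn
    have := (Finset.sum_eq_zero_iff_of_nonneg hnn).1 hl2
    exact hl0 (Finsupp.support_eq_empty.1 (Finset.eq_empty_of_forall_notMem fun i hi =>
      Finsupp.mem_support_iff.1 hi (this i hi)))
  obtain ⟨n₀, hn₀, hlt⟩ := hneg
  set S := lam.support.erase n₀ with hS
  have hsum : ∑ i ∈ S, lam i = -lam n₀ := by
    have := Finset.sum_erase_add lam.support (fun i => lam i) hn₀
    rw [hl2] at this
    linarith
  have hrel : ∑ i ∈ S, lam i • ((i : Fin d → ℤ) - n₀) = 0 := by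
    have := Finset.sum_erase_add lam.support (fun i => lam i • (i : Fin d → ℤ)) hn₀
    rw [hl1] at this
    simp_rw [smul_sub]
    rw [Finset.sum_sub_distrib, ← Finset.sum_smul, hsum, neg_smul, sub_neg_eq_add]
    exact this
  obtain ⟨j, hjS, hj⟩ : ∃ j ∈ S, Odd (lam j) := by
    by_contra hev
    push Not at hev
    have h1 : Even (∑ i ∈ S, lam i) := by
      rw [even_iff_two_dvd]
      exact Finset.dvd_sum fun i hi => (Int.not_odd_iff_even.1 (hev i hi)).two_dvd
    rw [hsum, even_neg] at h1
    have hjn : j = n₀ := by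
      by_contra hne
      refine hev j (Finset.mem_erase.2 ⟨hne, Finsupp.mem_support_iff.2 fun h0 => ?_⟩) hj
      rw [h0] at hj
      exact absurd hj (by decide)
    rw [hjn] at hj
    exact absurd hj (Int.not_odd_iff_even.2 h1)
  have hKL := sum_toNat_sub_sum_toNat_neg S lam
  rw [hsum] at hKL
  have hK2 : 2 ≤ ∑ i ∈ S, (lam i).toNat := by
    by_contra hK
    -- otherwise the relation is `n_j = n₀` for a single `j`
    have hL0 : ∑ i ∈ S, (-lam i).toNat = 0 := by omega
    have hK1 : ∑ i ∈ S, (lam i).toNat = 1 := by omega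
    have hge : ∀ i ∈ S, 1 ≤ (lam i).toNat := by
      intro i hi
      have h1 := Finset.sum_eq_zero_iff.1 hL0 i hi
      have h2 := Finsupp.mem_support_iff.1 (Finset.mem_of_mem_erase hi)
      omega
    have hcard : S.card ≤ 1 := by
      rw [← hK1, Finset.card_eq_sum_ones]
      exact Finset.sum_le_sum hge
    have hSj : S = {j} := Finset.eq_singleton_iff_unique_mem.2
      ⟨hjS, fun i hi => Finset.card_le_one.1 hcard i hi j hjS⟩
    rw [hSj, Finset.sum_singleton, smul_eq_zero, sub_eq_zero] at hrel
    rcases hrel with h0 | h0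
    · exact Finsupp.mem_support_iff.1 (Finset.mem_of_mem_erase hjS) h0
    · exact Finset.ne_of_mem_erase hjS (Subtype.ext h0)
  refine ⟨n₀, S, lam, j, (∑ i ∈ S, (lam i).toNat) - 2, ∑ i ∈ S, (-lam i).toNat,
    Finset.notMem_erase _ _, hjS, hrel, fun μ hμ => ?_, hj, by omega, rfl, by omega⟩
  -- complete `μ` by the coefficient at `n₀` that makes the total weight vanish
  set ν : Γ →₀ ℤ := Finsupp.indicator lam.support
    fun i _ => if i = n₀ then -∑ k ∈ S, μ k else μ i with hν
  have hνS : ∀ i ∈ S, ν i = μ i := fun i hi => by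
    rw [hν, Finsupp.indicator_of_mem (Finset.mem_of_mem_erase hi),
      if_neg (Finset.ne_of_mem_erase hi)]
  have hνn : ν n₀ = -∑ k ∈ S, μ k := by
    rw [hν, Finsupp.indicator_of_mem hn₀, if_pos rfl]
  have hνsub : ν.support ⊆ lam.support := Finsupp.support_indicator_subset _ _
  obtain ⟨q, hq⟩ := hgen ν hνsub ((hφ ν _ hνsub).2 ⟨by
      rw [← Finset.sum_erase_add _ _ hn₀, hνn, ← hμ]
      simp_rw [smul_sub]
      rw [Finset.sum_sub_distrib, ← Finset.sum_smul, neg_smul, ← sub_eq_add_neg]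
      exact congrArg₂ _ (Finset.sum_congr rfl fun i hi => by rw [hνS i hi]) rfl, by
      rw [← Finset.sum_erase_add _ _ hn₀, hνn, Finset.sum_congr rfl hνS]
      ring⟩)
  refine ⟨q, fun i hi => ?_⟩
  rw [← hνS i hi, hq, Finsupp.smul_apply, smul_eq_mul]

/-- The coefficients `1` at `n₀`, `ε * c i` at `i ∈ S`, and `0` elsewhere. -/
noncomputable def perturbCoeff {ι : Type*} [DecidableEq ι] (n₀ : ι) (S : Finset ι) (ε : ℝ)
    (c : ι → ℝ) : ι →₀ ℝ :=
  Finsupp.indicator (insert n₀ S) fun i _ => if i = n₀ then 1 else ε * c i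

theorem norm_torusPoly_perturbCoeff {d : ℕ} {Γ : Set (Fin d → ℤ)} [DecidableEq Γ] {n₀ : Γ}
    {S : Finset Γ} (hn₀ : n₀ ∉ S) (ε : ℝ) (c : Γ → ℝ) (t : UnitAddTorus (Fin d)) :
    ‖torusPoly (perturbCoeff n₀ S ε c) t‖ =
      ‖1 + ε * charSum (fun i : Γ => (i : Fin d → ℤ) - (n₀ : Fin d → ℤ)) S c t‖ := by
  have e1 : torusPoly (perturbCoeff n₀ S ε c) t = UnitAddTorus.mFourier (n₀ : Fin d → ℤ) t *
      (1 + ε * charSum (fun i : Γ => (i : Fin d → ℤ) - (n₀ : Fin d → ℤ)) S c t) := by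
    rw [torusPoly_eq_sum (perturbCoeff n₀ S ε c) (S := insert n₀ S)
      (Finsupp.support_indicator_subset _ _), Finset.sum_insert hn₀, mul_add, charSum,
      Finset.mul_sum, Finset.mul_sum]
    congr 1
    · simp [perturbCoeff]
    · refine Finset.sum_congr rfl fun i hi => ?_
      have hne : i ≠ n₀ := fun h => hn₀ (h ▸ hi)
      have e2 : UnitAddTorus.mFourier (i : Fin d → ℤ) t =
          UnitAddTorus.mFourier (n₀ : Fin d → ℤ) t *
          UnitAddTorus.mFourier ((i : Fin d → ℤ) - (n₀ : Fin d → ℤ)) t := by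
        rw [← UnitAddTorus.mFourier_add, add_sub_cancel]
      rw [e2, perturbCoeff, Finsupp.indicator_of_mem (Finset.mem_insert_of_mem hi), if_neg hne]
      push_cast
      ring
  rw [e1, norm_mul, norm_mFourier_apply, one_mul]

theorem absCoeff_perturbCoeff {d : ℕ} {Γ : Set (Fin d → ℤ)} [DecidableEq Γ] (n₀ : Γ)
    (S : Finset Γ) {ε : ℝ} (hε : 0 < ε) (j : Γ) :
    absCoeff (perturbCoeff n₀ S ε (flipSign j)) = perturbCoeff n₀ S ε 1 := by
  ext i
  simp only [absCoeff, perturbCoeff, Finsupp.mapRange_apply, Finsupp.indicator_apply]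
  split_ifs <;> simp [abs_mul, abs_flipSign, hε.le]

theorem hasIntervalViolation_of_not_affineIndependent {d : ℕ} {Γ : Set (Fin d → ℤ)}
    (h : ¬ AffineIndependent ℤ ((↑) : Γ → Fin d → ℤ)) : HasIntervalViolation Γ := by
  classical
  obtain ⟨n₀, S, lam, j, m, L, hn₀, hj, hrel, hgen, hodd, hK, hL, hLm⟩ := exists_circuit h
  obtain ⟨ε, hε0, hε⟩ := exists_forall_integral_lt _ hj hrel hgen hodd hK hL hLm
  refine ⟨m, perturbCoeff n₀ S ε (flipSign j), fun p hp => ?_⟩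
  have hp0 : 0 < p := lt_of_le_of_lt (by positivity) hp.1
  rw [absCoeff_perturbCoeff n₀ S hε0, ← not_le, cubeNorm_trigPoly_le_iff _ _ hp0, not_le]
  simp_rw [norm_torusPoly_perturbCoeff hn₀]
  exact hε p hp

theorem not_forall_hasStrictMajorantProperty {d : ℕ} {Γ : Set (Fin d → ℤ)}
    (h : HasIntervalViolation Γ) : ¬ ∀ p : ℝ, 0 < p → HasStrictMajorantProperty Γ p := by
  obtain ⟨m, a, ha⟩ := h
  intro hmaj
  refine (hmaj (2 * m + 1) (by positivity) a (absCoeff a) fun n => ?_).not_gt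
    (ha _ ⟨by linarith, by linarith⟩)
  simp [absCoeff]

end StrictMajorant

theorem theorem1p1 (d : ℕ) (hd : 1 ≤ d) :
    (∀ Γ : Set (Fin d → ℤ), Γ.Nonempty →
      ((∀ p : ℝ, 0 < p → StrictMajorant.HasStrictMajorantProperty Γ p) ↔
        AffineIndependent ℤ ((↑) : Γ → Fin d → ℤ))) ∧
    (∀ Γ : Set (Fin d → ℤ), ¬ AffineIndependent ℤ ((↑) : Γ → Fin d → ℤ) →
      StrictMajorant.HasIntervalViolation Γ) ∧
    (∀ Γ : Set (Fin d → ℤ), ((d + 2 : ℕ) : ℕ∞) ≤ Γ.encard →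
      StrictMajorant.HasIntervalViolation Γ) := by
  refine ⟨fun Γ _ => ⟨fun h => ?_, fun h p hp =>
    StrictMajorant.hasStrictMajorantProperty_of_affineIndependent h hp⟩,
    fun Γ h => StrictMajorant.hasIntervalViolation_of_not_affineIndependent h,
    fun Γ h => StrictMajorant.hasIntervalViolation_of_not_affineIndependent
      (StrictMajorant.not_affineIndependent_of_le_encard h)⟩
  by_contra hai
  exact StrictMajorant.not_forall_hasStrictMajorantProperty
    (StrictMajorant.hasIntervalViolation_of_not_affineIndependent hai) h
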